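/- **Setting.** Let $A$ be a set of actions with a distinguished action $\surd\in A$ (successful termination). The signature $\Sigma_{PA}$ has the constants $0$ and $\varepsilon$; the $n$-ary prefix operators $a.\bigoplus_{i=1}^n[p_i]\_$ ($a\in A$, $n\ge 1$, $p_i\in(0,1]$, $\sum_i p_i=1$); and the binary operators $;$, $+$, $+_p$, $\mid$, $|||$, $|||_p$ ($p\in(0,1)$) and $\parallel_B$ ($B\subseteq A$). For a signature $\Sigma$ let $\mathsf T(\Sigma)$ be its set of closed terms and $\Delta(\mathsf T(\Sigma))$ the set of discrete probability distributions on it; $\delta(t)$ is the Dirac distribution, $\pi\oplus_p\pi'=p\pi+(1-p)\pi'$ (also written $\mu\oplus_p\nu$), and $f(\pi_1,\dots,\pi_n)$ is the image of the product distribution under $f$. The operational rules $R_{PA}$ are ($\xrightarrow{a}$ with $a\in A$ arbitrary unless restricted): - $\varepsilon\xrightarrow{\surd}\delta(0)$; $\quad a.\bigoplus_i[p_i]x_i\xrightarrow{a}\sum_i p_i\delta(x_i)$; no rule for $0$. - $x;y\xrightarrow{a}\mu;\delta(y)$ if $x\xrightarrow{a}\mu$, $a\ne\surd$; $\quad x;y\xrightarrow{a}\nu$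 if $x\xrightarrow{\surd}\mu$, $y\xrightarrow{a}\nu$. - $x+y\xrightarrow{a}\mu$ if $x\xrightarrow{a}\mu$; $\quad x+y\xrightarrow{a}\nu$ if $y\xrightarrow{a}\nu$. - $x+_py\xrightarrow{a}\mu$ if $x\xrightarrow{a}\mu$, $y\not\xrightarrow{a}$; $\quad x+_py\xrightarrow{a}\nu$ if $x\not\xrightarrow{a}$, $y\xrightarrow{a}\nu$; $\quad x+_py\xrightarrow{a}\mu\oplus_p\nu$ if $x\xrightarrow{a}\mu$, $y\xrightarrow{a}\nu$. - $x\mid y\xrightarrow{a}\mu\mid\nu$ if $x\xrightarrow{a}\mu$, $y\xrightarrow{a}\nu$, $a\neq\surd$. - $x\,|||\,y\xrightarrow{a}\mu\,|||\,\delta(y)$ if $x\xrightarrow{a}\mu$, $a\ne\surd$; $\quad x\,|||\,y\xrightarrow{a}\delta(x)\,|||\,\nu$ if $y\xrightarrow{a}\nu$, $a\ne\surd$. - $x\parallel_By\xrightarrow{a}\mu\parallel_B\nu$ if $x\xrightarrow{a}\mu$, $y\xrightarrow{a}\nu$, $a\in B\setminus\{\surd\}$; $\quad x\parallel_By\xrightarrow{a}\mu\parallel_B\delta(y)$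 if $x\xrightarrow{a}\mu$, $a\notin B\cup\{\surd\}$; $\quad x\parallel_By\xrightarrow{a}\delta(x)\parallel_B\nu$ if $y\xrightarrow{a}\nu$, $a\notin B\cup\{\surd\}$. - for $a\ne\surd$: $x\,|||_p\,y\xrightarrow{a}\mu\,|||_p\,\delta(y)$ if $x\xrightarrow{a}\mu$, $y\not\xrightarrow{a}$; $\quad x\,|||_p\,y\xrightarrow{a}\delta(x)\,|||_p\,\nu$ if $x\not\xrightarrow{a}$, $y\xrightarrow{a}\nu$; $\quad x\,|||_p\,y\xrightarrow{a}(\mu\,|||_p\,\delta(y))\oplus_p(\delta(x)\,|||_p\,\nu)$ if $x\xrightarrow{a}\mu$, $y\xrightarrow{a}\nu$. - for each $f\in\{\mid,|||,|||_p,\parallel_B\}$: $f(x,y)\xrightarrow{\surd}\delta(0)$ if $x\xrightarrow{\surd}\mu$, $y\xrightarrow{\surd}\nu$. A PGSOS rule for an $n$-ary operator $f$ has finitely many premises $x_i\xrightarrow{a}\mu$ and $x_i\not\xrightarrow{b}$ on the pairwise different arguments $x_1,\dots,x_n$, with pairwise different distribution variables $\mu$, and a conclusion $f(x_1,\dots,x_n)\xrightarrow{c}\theta$,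 where $\theta$ is built from these variables $\mu$ and from $\delta(t)$, $t$ a term over $x_1,\dots,x_n$, by convex combinations and operators. A specification $P=(\Sigma,A,R)$ is a set $R$ of such rules for operators of $\Sigma$, with finitely many rules for each operator and each label of the conclusion; it induces a unique transition relation on $\mathsf T(\Sigma)\times A\times\Delta(\mathsf T(\Sigma))$ consisting of exactly the transitions that are conclusions of instances of rules whose premises hold. $P$ is a disjoint extension of $P_{PA}=(\Sigma_{PA},A,R_{PA})$ if $\Sigma_{PA}\subseteq\Sigma$, $R_{PA}\subseteq R$, and $R$ has no further rule for an operator of $\Sigma_{PA}$. For $\lambda\in(0,1]$, a $\lambda$-bisimulation metric is a pseudometric $d:\mathsf T(\Sigma)^2\to[0,1]$ such that whenever $d(t,t')<1$ and $t\xrightarrow{a}\pi$ there is $t'\xrightarrow{a}\pi'$ with $\lambda\cdot\mathbf K(d)(\pi,\pi')\le d(t,t')$, where $\mathbf K(d)(\pi,\pi')$ is the minimum (infimum) of $\sum_{t,t'}d(t,t')\,\omega(t,t')$ over the distributions $\omega$ on $\mathsf T(\Sigma)^2$ with marginals $\pi,\pi'$. The $\lambda$-bisimilarity metric $\mathbf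 d$ is the pointwise smallest $\lambda$-bisimulation metric. **Theorem.** Let $P=(\Sigma,A,R)$ be a disjoint extension of $P_{PA}$ and $\lambda\in(0,1]$. Then the $\lambda$-bisimilarity metric $\mathbf d$ on $\mathsf T(\Sigma)$ exists, and every operator $f$ of $\Sigma_{PA}$ is non-expansive with respect to it: with $n$ the arity of $f$, $$\mathbf d\big(f(s_1,\dots,s_n),f(t_1,\dots,t_n)\big)\le\sum_{i=1}^n\mathbf d(s_i,t_i)\qquad\text{for all } s_i,t_i\in\mathsf T(\Sigma).$$ -/

import Mathlib

open scoped ENNReal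

universe u v w

namespace ProbPA

/-! ### Processes

State terms over a signature `L` and a set `V` of variables are `L.Term V`. -/

/-- A signature; its operators of rank `n` are the function symbols `L.Functions n` (relation
symbols play no role). -/
abbrev Signature := FirstOrder.Language.{u, 0}

/-- Processes are closed state terms. -/
abbrev Proc (L : Signature.{u}) : Type u := L.Term Empty

/-- The product `π₁ ⊗ ⋯ ⊗ πₙ` of finitely many discrete distributions. -/
noncomputable def prodPMF {X : Type u} : {n : ℕ} → (Fin n → PMF X) → PMF (Fin n → X)
  | 0, _ => PMF.pure Fin.elim0
  | _ + 1, π => (π 0).bind fun x => (prodPMF fun i => π i.succ).map fun xs => Fin.cons x xs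

theorem prodPMF_apply {X : Type u} {n : ℕ} (π : Fin n → PMF X) (x : Fin n → X) :
    prodPMF π x = ∏ i, π i (x i) := by
  classical
  induction n with
  | zero =>
    have : x = Fin.elim0 := Subsingleton.elim _ _
    simp [prodPMF, this]
  | succ n ih =>
    rw [prodPMF, PMF.bind_apply, Fin.prod_univ_succ, tsum_eq_single (x 0)]
    · congr 1
      rw [PMF.map_apply, tsum_eq_single (fun i => x i.succ)]
      · rw [if_pos, ih]
        exact (Fin.cons_self_tail x).symm
      · intro y hy
        rw [if_neg]
        intro h
        exact hy (by rw [h]; simp)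
    · intro y hy
      rw [PMF.map_apply]
      refine mul_eq_zero_of_right _ (ENNReal.tsum_eq_zero.2 fun z => if_neg ?_)
      intro h
      exact hy (by rw [h]; simp)

/-- The two-point distribution giving `p` to `0` and `1 - p` to `1`. -/
noncomputable def coin (p : ℝ≥0∞) (hp : p ≤ 1) : PMF (Fin 2) :=
  PMF.ofFintype ![p, 1 - p] (by simp [Fin.sum_univ_two, hp])

/-- Distribution terms over state variables `Vs` and distribution variables `Vd`.
The weights of a convex combination form a distribution on its index set. -/
inductive DTerm (L : Signature.{u}) (Vs Vd : Type) : Type (max u 1)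
  | var (μ : Vd) : DTerm L Vs Vd
  | dirac (t : L.Term Vs) : DTerm L Vs Vd
  | sum {I : Type} (p : PMF I) (θ : I → DTerm L Vs Vd) : DTerm L Vs Vd
  | app {n : ℕ} (f : L.Functions n) (θ : Fin n → DTerm L Vs Vd) : DTerm L Vs Vd

namespace DTerm

variable {L : Signature.{u}} {Vs Vd : Type}

/-- The convex combination `θ₁ ⊕_p θ₂`. -/
noncomputable def choice (p : ℝ≥0∞) (hp : p ≤ 1) (θ₁ θ₂ : DTerm L Vs Vd) : DTerm L Vs Vd :=
  .sum (coin p hp) ![θ₁, θ₂]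

/-- The distribution denoted by a distribution term under a closed substitution.
Every distribution is denoted by a closed distribution term (a convex combination of Dirac
distributions), so distribution variables are instantiated directly by distributions. -/
noncomputable def eval (σ : Vs → Proc L) (ρ : Vd → PMF (Proc L)) :
    DTerm L Vs Vd → PMF (Proc L)
  | var μ => ρ μ
  | dirac t => PMF.pure (t.subst σ)
  | sum p θ => p.bind fun i => eval σ ρ (θ i)
  | app f θ => (prodPMF fun i => eval σ ρ (θ i)).map fun ts => FirstOrder.Language.Term.func f ts

/-- Transport of a distribution term along an inclusion of signatures. -/
noncomputable def onLHom {L' : Signature.{w}} (ι : L.LHom L') :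
    DTerm L Vs Vd → DTerm L' Vs Vd
  | var μ => .var μ
  | dirac t => .dirac (ι.onTerm t)
  | sum p θ => .sum p fun i => onLHom ι (θ i)
  | app f θ => .app (ι.onFunction f) fun i => onLHom ι (θ i)

end DTerm

/-! ### Transition systems and their specification by PGSOS rules -/

/-- The transition relation of a PTS: `M t a π` says `t —a→ π`. -/
abbrev PTS (L : Signature.{u}) (A : Type v) := Proc L → A → PMF (Proc L) → Prop

/-- A PGSOS rule for an operator of rank `n`.  Variables are numbered: the source variables are
`x_i`, `i : Fin n`, and the `k`-th positive premise `x_i —a→ μ_k` is given by `pos k = (i, a)`.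
Thus all variables are pairwise different, and only they may occur in the target. A pair
`(i, b)` in `neg` stands for the negative premise "`x_i` has no `b`-transition". -/
structure PGSOSRule (L : Signature.{u}) (A : Type v) (n : ℕ) where
  numPos : ℕ
  pos : Fin numPos → Fin n × A
  neg : Finset (Fin n × A)
  act : A
  target : DTerm L (Fin n) (Fin numPos)

namespace PGSOSRule

variable {L : Signature.{u}} {A : Type v} {n : ℕ}

/-- The premises of `r` hold in `M` when `x_i` is `ts i` and `μ_k` is `ρ k`. -/
def Premises (r : PGSOSRule L A n) (M : PTS L A) (ts : Fin n → Proc L)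
    (ρ : Fin r.numPos → PMF (Proc L)) : Prop :=
  (∀ k, M (ts (r.pos k).1) (r.pos k).2 (ρ k)) ∧
    ∀ q ∈ r.neg, ∀ π, ¬ M (ts q.1) q.2 π

/-- Transport of a rule along an inclusion of signatures. -/
noncomputable def onLHom {L' : Signature.{w}} (ι : L.LHom L')
    (r : PGSOSRule L A n) : PGSOSRule L' A n where
  numPos := r.numPos
  pos := r.pos
  neg := r.neg
  act := r.act
  target := r.target.onLHom ι

end PGSOSRule

/-- A PTSS in PGSOS format; `rules f` is the set of rules with source `f(x₁,…,xₙ)`. -/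
structure PTSS (L : Signature.{u}) (A : Type v) where
  rules : ∀ {n : ℕ}, L.Functions n → Set (PGSOSRule L A n)
  finite_rules : ∀ {n : ℕ} (f : L.Functions n) (a : A), {r ∈ rules f | r.act = a}.Finite

namespace PTSS

variable {L : Signature.{u}} {A : Type v}

/-- In `M`, some instance of a rule of `P` with valid premises has conclusion `t —a→ π`. -/
def Supports (P : PTSS L A) (M : PTS L A) (t : Proc L) (a : A) (π : PMF (Proc L)) : Prop :=
  ∃ (n : ℕ) (f : L.Functions n) (ts : Fin n → Proc L), ∃ r ∈ P.rules f,
    ∃ ρ : Fin r.numPos → PMF (Proc L), r.Premises M ts ρ ∧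
      t = FirstOrder.Language.Term.func f ts ∧ a = r.act ∧ π = r.target.eval ts ρ

/-- `M` contains all and only the transitions supported by `P`. -/
def IsSupportedModel (P : PTSS L A) (M : PTS L A) : Prop :=
  ∀ t a π, M t a π ↔ P.Supports M t a π

/-- The induced model of `P`, by recursion on the source term; it is the unique supported
model (`isSupportedModel_iff`). -/
def inducedModel (P : PTSS L A) : PTS L A
  | .var x, _, _ => x.elim
  | .func f ts, a, π => ∃ r ∈ P.rules f, ∃ ρ : Fin r.numPos → PMF (Proc L),
      ((∀ k, inducedModel P (ts (r.pos k).1) (r.pos k).2 (ρ k)) ∧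
        ∀ q ∈ r.neg, ∀ π', ¬ inducedModel P (ts q.1) q.2 π') ∧
      a = r.act ∧ π = r.target.eval ts ρ

theorem isSupportedModel_inducedModel (P : PTSS L A) : P.IsSupportedModel P.inducedModel := by
  intro t a π
  cases t with
  | var x => exact x.elim
  | func f ts =>
    rw [inducedModel]
    constructor
    · rintro ⟨r, hr, ρ, hp, ha, hπ⟩
      exact ⟨_, f, ts, r, hr, ρ, hp, rfl, ha, hπ⟩
    · rintro ⟨n, f', ts', r, hr, ρ, hp, ht, ha, hπ⟩
      cases ht
      exact ⟨r, hr, ρ, hp, ha, hπ⟩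

theorem isSupportedModel_iff (P : PTSS L A) (M : PTS L A) :
    P.IsSupportedModel M ↔ M = P.inducedModel := by
  refine ⟨fun h => ?_, fun h => h ▸ P.isSupportedModel_inducedModel⟩
  funext t
  induction t with
  | var x => exact x.elim
  | func f ts ih =>
    funext a π
    rw [inducedModel]
    refine propext ((h _ _ _).trans ⟨?_, ?_⟩)
    · rintro ⟨n, f', ts', r, hr, ρ, hp, ht, ha, hπ⟩
      cases ht
      simp only [PGSOSRule.Premises, ih] at hp
      exact ⟨r, hr, ρ, hp, ha, hπ⟩
    · rintro ⟨r, hr, ρ, hp, ha, hπ⟩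
      refine ⟨_, f, ts, r, hr, ρ, ?_, rfl, ha, hπ⟩
      simpa only [PGSOSRule.Premises, ih] using hp

/-- `P₂` is a disjoint extension of `P₁` along the inclusion `ι` of signatures: it has the rules
of `P₁`, and no other rule for an operator of `P₁`. -/
structure IsDisjointExtension {L₁ : Signature.{w}} {L₂ : Signature.{u}} {A : Type v}
    (ι : L₁.LHom L₂) (P₁ : PTSS L₁ A) (P₂ : PTSS L₂ A) : Prop where
  injective : ∀ n, Function.Injective fun f : L₁.Functions n => ι.onFunction f
  rules_eq : ∀ {n : ℕ} (f : L₁.Functions n),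
    P₂.rules (ι.onFunction f) = PGSOSRule.onLHom ι '' P₁.rules f

end PTSS

/-! ### The bisimilarity metric

Distances in `[0,1]` are represented by functions into `ℝ≥0∞` bounded by `1`. -/

/-- `1`-bounded pseudometrics. -/
structure IsPseudometric {X : Type u} (d : X → X → ℝ≥0∞) : Prop where
  le_one : ∀ x y, d x y ≤ 1
  refl : ∀ x, d x x = 0
  symm : ∀ x y, d x y = d y x
  triangle : ∀ x y z, d x z ≤ d x y + d y z

/-- The matchings of two distributions. -/
def Matchings {X : Type u} (π π' : PMF X) : Set (PMF (X × X)) :=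
  {ω | ω.map Prod.fst = π ∧ ω.map Prod.snd = π'}

/-- The Kantorovich lifting. -/
noncomputable def kantorovich {X : Type u} (d : X → X → ℝ≥0∞) (π π' : PMF X) : ℝ≥0∞ :=
  ⨅ ω ∈ Matchings π π', ∑' x : X × X, d x.1 x.2 * ω x

/-- `d` is a `lam`-bisimulation metric on the PTS `M`. -/
structure IsBisimMetric {L : Signature.{u}} {A : Type v} (M : PTS L A) (lam : ℝ≥0∞)
    (d : Proc L → Proc L → ℝ≥0∞) : Prop where
  pseudometric : IsPseudometric d
  transfer : ∀ t t', d t t' < 1 → ∀ a π, M t a π →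
    ∃ π', M t' a π' ∧ lam * kantorovich d π π' ≤ d t t'

/-- `d` is the `lam`-bisimilarity metric: the smallest `lam`-bisimulation metric in the
pointwise order. -/
def IsBisimilarityMetric {L : Signature.{u}} {A : Type v} (M : PTS L A) (lam : ℝ≥0∞)
    (d : Proc L → Proc L → ℝ≥0∞) : Prop :=
  IsLeast {e | IsBisimMetric M lam e} d

/-- The operator `f` is non-expansive with respect to `d`. -/
def NonExpansive {L : Signature.{u}} (d : Proc L → Proc L → ℝ≥0∞) {n : ℕ}
    (f : L.Functions n) : Prop :=
  ∀ s t : Fin n → Proc L,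
    d (FirstOrder.Language.Term.func f s) (FirstOrder.Language.Term.func f t) ≤ ∑ i, d (s i) (t i)

/-! ### The process algebra `PA` -/

/-- The operators of `Σ_PA`, indexed by rank. In `pre` the weights `pᵢ` are given as a
distribution on `Fin n` of full support, which forces `n ≥ 1`. -/
inductive PAOp (A : Type v) : ℕ → Type v
  | nil : PAOp A 0
  | skip : PAOp A 0
  | pre (a : A) {n : ℕ} (p : PMF (Fin n)) (hp : ∀ i, 0 < p i) : PAOp A n
  | seq : PAOp A 2
  | alt : PAOp A 2
  | palt (p : ℝ≥0∞) (hp₀ : 0 < p) (hp₁ : p < 1) : PAOp A 2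
  | sync : PAOp A 2
  | async : PAOp A 2
  | pasync (p : ℝ≥0∞) (hp₀ : 0 < p) (hp₁ : p < 1) : PAOp A 2
  | csp (B : Set A) : PAOp A 2

/-- The signature `Σ_PA`. -/
def paSig (A : Type v) : Signature.{v} := ⟨PAOp A, fun _ => Empty⟩

section Rules

variable {A : Type v}

/-- Distribution terms in the targets of rules for binary operators with `k` positive
premises. -/
abbrev Tgt (A : Type v) (k : ℕ) := DTerm (paSig A) (Fin 2) (Fin k)

/-- `θ₁ f θ₂`. -/
def bin {k : ℕ} (f : PAOp A 2) (θ₁ θ₂ : Tgt A k) : Tgt A k :=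
  DTerm.app (L := paSig A) f ![θ₁, θ₂]

/-- `δ(x)`, for `x` the first source variable. -/
def dx {k : ℕ} : Tgt A k := .dirac (.var 0)

/-- `δ(y)`, for `y` the second source variable. -/
def dy {k : ℕ} : Tgt A k := .dirac (.var 1)

/-- `δ(0)`. -/
def dnil {m k : ℕ} : DTerm (paSig A) (Fin m) (Fin k) :=
  .dirac (.func (L := paSig A) PAOp.nil Fin.elim0)

/-- The rule with premise `x —a→ μ` and conclusion `f(x,y) —a→ θ`, with `μ = .var 0`. -/
def ruleL (a : A) (θ : Tgt A 1) : PGSOSRule (paSig A) A 2 :=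
  ⟨1, ![(0, a)], ∅, a, θ⟩

/-- The rule with premise `y —a→ ν` and conclusion `f(x,y) —a→ θ`, with `ν = .var 0`. -/
def ruleR (a : A) (θ : Tgt A 1) : PGSOSRule (paSig A) A 2 :=
  ⟨1, ![(1, a)], ∅, a, θ⟩

/-- As `ruleL`, with the additional premise that `y` has no `a`-transition. -/
def ruleLneg (a : A) (θ : Tgt A 1) : PGSOSRule (paSig A) A 2 :=
  ⟨1, ![(0, a)], {(1, a)}, a, θ⟩

/-- As `ruleR`, with the additional premise that `x` has no `a`-transition. -/
def ruleRneg (a : A) (θ : Tgt A 1) : PGSOSRule (paSig A) A 2 :=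
  ⟨1, ![(1, a)], {(0, a)}, a, θ⟩

/-- The rule with premises `x —b→ μ`, `y —a→ ν` and conclusion `f(x,y) —a→ θ`, with
`μ = .var 0` and `ν = .var 1`. -/
def ruleLR (b a : A) (θ : Tgt A 2) : PGSOSRule (paSig A) A 2 :=
  ⟨2, ![(0, b), (1, a)], ∅, a, θ⟩

/-- The rules of `PA`; `tick` is the successful termination action. -/
noncomputable def paRules (tick : A) : {n : ℕ} → PAOp A n → Set (PGSOSRule (paSig A) A n)
  | _, .nil => ∅
  | _, .skip => {⟨0, Fin.elim0, ∅, tick, dnil⟩}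
  | _, .pre a p _ => {⟨0, Fin.elim0, ∅, a, .sum p fun i => .dirac (.var i)⟩}
  | _, .seq =>
      {r | ∃ a, a ≠ tick ∧ r = ruleL a (bin .seq (.var 0) dy)} ∪
      {r | ∃ a, r = ruleLR tick a (.var 1)}
  | _, .alt =>
      {r | ∃ a, r = ruleL a (.var 0)} ∪
      {r | ∃ a, r = ruleR a (.var 0)}
  | _, .palt p _ h =>
      {r | ∃ a, r = ruleLneg a (.var 0)} ∪
      {r | ∃ a, r = ruleRneg a (.var 0)} ∪
      {r | ∃ a, r = ruleLR a a (.choice p h.le (.var 0) (.var 1))}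
  | _, .sync =>
      {r | ∃ a, a ≠ tick ∧ r = ruleLR a a (bin .sync (.var 0) (.var 1))} ∪
      {ruleLR tick tick dnil}
  | _, .async =>
      {r | ∃ a, a ≠ tick ∧ r = ruleL a (bin .async (.var 0) dy)} ∪
      {r | ∃ a, a ≠ tick ∧ r = ruleR a (bin .async dx (.var 0))} ∪
      {ruleLR tick tick dnil}
  | _, .pasync p h₀ h =>
      {r | ∃ a, a ≠ tick ∧ r = ruleLneg a (bin (.pasync p h₀ h) (.var 0) dy)} ∪
      {r | ∃ a, a ≠ tick ∧ r = ruleRneg a (bin (.pasync p h₀ h) dx (.var 0))} ∪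
      {r | ∃ a, a ≠ tick ∧ r = ruleLR a a (.choice p h.le
        (bin (.pasync p h₀ h) (.var 0) dy) (bin (.pasync p h₀ h) dx (.var 1)))} ∪
      {ruleLR tick tick dnil}
  | _, .csp B =>
      {r | ∃ a, a ∈ B \ {tick} ∧ r = ruleLR a a (bin (.csp B) (.var 0) (.var 1))} ∪
      {ruleLR tick tick dnil} ∪
      {r | ∃ a, a ∉ B ∪ {tick} ∧ r = ruleL a (bin (.csp B) (.var 0) dy)} ∪
      {r | ∃ a, a ∉ B ∪ {tick} ∧ r = ruleR a (bin (.csp B) dx (.var 0))}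

/-- The specification `P_PA`. -/
noncomputable def paPTSS (tick : A) : PTSS (paSig A) A where
  rules f := paRules tick f
  finite_rules {n} f a := by
    have key : ∀ (p : A → Prop) (g : A → PGSOSRule (paSig A) A 2),
        (∀ b, (g b).act = b) → {r ∈ {r | ∃ b, p b ∧ r = g b} | r.act = a}.Finite := by
      intro p g hg
      refine (Set.finite_singleton (g a)).subset ?_
      rintro r ⟨⟨b, -, rfl⟩, hb⟩
      rw [hg] at hb
      rw [hb]; rfl
    have key' : ∀ (g : A → PGSOSRule (paSig A) A 2),
        (∀ b, (g b).act = b) → {r ∈ {r | ∃ b, r = g b} | r.act = a}.Finite := by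
      intro g hg
      simpa using key (fun _ => True) g hg
    have one : ∀ {m : ℕ} (q : PGSOSRule (paSig A) A m),
        {r ∈ ({q} : Set (PGSOSRule (paSig A) A m)) | r.act = a}.Finite :=
      fun q => (Set.finite_singleton q).subset fun _ h => h.1
    have cup : ∀ {m : ℕ} {s t : Set (PGSOSRule (paSig A) A m)},
        {r ∈ s | r.act = a}.Finite → {r ∈ t | r.act = a}.Finite →
          {r ∈ s ∪ t | r.act = a}.Finite := by
      intro m s t hs ht
      refine (hs.union ht).subset ?_
      rintro r ⟨h | h, hr⟩
      exacts [Or.inl ⟨h, hr⟩, Or.inr ⟨h, hr⟩]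
    cases f with
    | nil => exact Set.finite_empty.subset fun _ h => h.1
    | skip => exact one _
    | pre b p hp => exact one _
    | seq => exact cup (key _ _ fun _ => rfl) (key' _ fun _ => rfl)
    | alt => exact cup (key' _ fun _ => rfl) (key' _ fun _ => rfl)
    | palt p h₀ h =>
      exact cup (cup (key' _ fun _ => rfl) (key' _ fun _ => rfl)) (key' _ fun _ => rfl)
    | sync => exact cup (key _ _ fun _ => rfl) (one _)
    | async => exact cup (cup (key _ _ fun _ => rfl) (key _ _ fun _ => rfl)) (one _)
    | pasync p h₀ h =>
      exact cup (cup (cup (key _ _ fun _ => rfl) (key _ _ fun _ => rfl))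
        (key _ _ fun _ => rfl)) (one _)
    | csp B =>
      exact cup (cup (cup (key _ _ fun _ => rfl) (one _)) (key _ _ fun _ => rfl))
        (key _ _ fun _ => rfl)

end Rules

end ProbPA

namespace ProbPA

/-! ### Kantorovich lifting -/

section Kantorovich

variable {X Y : Type u}

/-! Both halves are lower-approximation arguments for the monotone map `bisimStep`. Suprema of
pseudometrics are pseudometrics, so if a family of pseudometrics is closed under `bisimStep` and
contains its own supremum, that supremum is a prefixed point. By image finiteness a prefixed
pseudometric is a bisimulation metric (`isBisimMetric_of_bisimStep_le`).

For existence the family consists of the pseudometrics below every bisimulation metric. For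
non-expansiveness it consists of the pseudometrics `c ≤ d` with `c (f s) (f t) ≤ ∑ d (s i) (t i)`
for all operators `f` of `PA`; its supremum is a bisimulation metric, hence dominates `d`, and `d`
inherits the bound.

Closure of the second family (`simCost_func_le`) rests on the shape of the rules: along each branch
of a convex combination, a target uses each argument at most once, either as a derivative or
unchanged. `mul_kantorovich_target_le` turns this into a bound by the sum of the distances, using
that the Kantorovich lifting is subadditive on products (`kantorovich_prodPMF_le`) and convex on
mixtures (`kantorovich_bind_le_of_coupling`). -/

theorem map_fst_apply (ω : PMF (X × X)) (x : X) : ω.map Prod.fst x = ∑' y, ω (x, y) := by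
  classical
  rw [PMF.map_apply, ENNReal.tsum_prod', tsum_eq_single x fun b hb => by simp [hb.symm]]
  simp

theorem map_snd_apply (ω : PMF (X × X)) (y : X) : ω.map Prod.snd y = ∑' x, ω (x, y) := by
  classical
  rw [PMF.map_apply, ENNReal.tsum_prod', ENNReal.tsum_comm,
    tsum_eq_single y fun b hb => by simp [hb.symm]]
  simp

theorem tsum_prod_fst_eq_of_matching {π π' : PMF X} {ω : PMF (X × X)} (h : ω ∈ Matchings π π')
    (x : X) : ∑' y, ω (x, y) = π x := by
  rw [← h.1, map_fst_apply]

theorem tsum_prod_snd_eq_of_matching {π π' : PMF X} {ω : PMF (X × X)} (h : ω ∈ Matchings π π')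
    (y : X) : ∑' x, ω (x, y) = π' y := by
  rw [← h.2, map_snd_apply]

theorem mem_matchings_of_tsum {π π' : PMF X} {ω : PMF (X × X)}
    (h₁ : ∀ x, ∑' y, ω (x, y) = π x) (h₂ : ∀ y, ∑' x, ω (x, y) = π' y) :
    ω ∈ Matchings π π' :=
  ⟨PMF.ext fun x => (map_fst_apply ω x).trans (h₁ x),
    PMF.ext fun y => (map_snd_apply ω y).trans (h₂ y)⟩

/-- The product of two distributions is a matching. -/
theorem matchings_nonempty (π π' : PMF X) : (Matchings π π').Nonempty := by
  refine ⟨π.bind fun x => π'.map fun y => (x, y), ?_, ?_⟩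
  · simp only [PMF.map_bind, PMF.map_comp, Function.comp_def]
    exact (congrArg _ (funext fun x => PMF.map_const π' x)).trans π.bind_pure
  · simp only [PMF.map_bind, PMF.map_comp, Function.comp_def, PMF.bind_const]
    exact π'.map_id

theorem kantorovich_le_of_matching (d : X → X → ℝ≥0∞) {π π' : PMF X} {ω : PMF (X × X)}
    (h : ω ∈ Matchings π π') : kantorovich d π π' ≤ ∑' x : X × X, d x.1 x.2 * ω x :=
  iInf₂_le ω h

/-- Near-optimal matchings suffice, so attainment of the infimum is never needed. Infinite cost is
possible since `d` is not assumed bounded; then any matching serves. -/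
theorem exists_matching_le_add (d : X → X → ℝ≥0∞) (π π' : PMF X) {ε : ℝ≥0∞} (hε : ε ≠ 0) :
    ∃ ω ∈ Matchings π π', ∑' x : X × X, d x.1 x.2 * ω x ≤ kantorovich d π π' + ε := by
  by_cases h : kantorovich d π π' = ⊤
  · obtain ⟨ω, hω⟩ := matchings_nonempty π π'
    exact ⟨ω, hω, by simp [h]⟩
  · have := ENNReal.lt_add_right h hε
    rw [kantorovich] at this
    obtain ⟨ω, hω, hlt⟩ := by simpa only [iInf_lt_iff] using this
    exact ⟨ω, hω, hlt.le⟩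

theorem kantorovich_mono {c d : X → X → ℝ≥0∞} (h : c ≤ d) (π π' : PMF X) :
    kantorovich c π π' ≤ kantorovich d π π' :=
  iInf₂_mono fun _ _ => ENNReal.tsum_le_tsum fun x => mul_le_mul_left (h x.1 x.2) _

theorem kantorovich_const_add_le (a : ℝ≥0∞) (d : X → X → ℝ≥0∞) (π π' : PMF X) :
    kantorovich (fun x y => a + d x y) π π' ≤ a + kantorovich d π π' := by
  simp only [kantorovich, ENNReal.add_iInf]
  refine le_iInf₂ fun ω hω => (iInf₂_le ω hω).trans ?_
  simp only [add_mul, ENNReal.tsum_add, ENNReal.tsum_mul_left, ω.tsum_coe, mul_one, le_refl]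

theorem tsum_mul_bind (c : Y → ℝ≥0∞) {Z : Type*} (p : PMF Z) (f : Z → PMF Y) :
    ∑' y, c y * p.bind f y = ∑' z, p z * ∑' y, c y * f z y := by
  simp only [PMF.bind_apply, ← ENNReal.tsum_mul_left]
  rw [ENNReal.tsum_comm]
  exact tsum_congr fun z => tsum_congr fun y => by ring

theorem tsum_mul_map {Z : Type*} (c : Y → ℝ≥0∞) (p : PMF Z) (f : Z → Y) :
    ∑' y, c y * p.map f y = ∑' z, c (f z) * p z := by
  classical
  rw [← PMF.bind_pure_comp, tsum_mul_bind]
  refine tsum_congr fun z => ?_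
  rw [tsum_eq_single (f z) fun y hy => by simp [hy]]
  simp [mul_comm]

/-- A matching is pushed forward along the product of the two maps. -/
theorem kantorovich_map_le (c : Y → Y → ℝ≥0∞) (h h' : X → Y) (π π' : PMF X) :
    kantorovich c (π.map h) (π'.map h') ≤ kantorovich (fun x y => c (h x) (h' y)) π π' := by
  refine le_iInf₂ fun ω hω => ?_
  have hm : ω.map (Prod.map h h') ∈ Matchings (π.map h) (π'.map h') := by
    constructor
    · rw [← hω.1, PMF.map_comp, PMF.map_comp]; rfl
    · rw [← hω.2, PMF.map_comp, PMF.map_comp]; rfl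
  refine (kantorovich_le_of_matching c hm).trans_eq ?_
  rw [tsum_mul_map (fun z : Y × Y => c z.1 z.2)]
  rfl

/-- Matchings of the components of a mixture can be mixed, if the indices are coupled by `ω`. -/
theorem kantorovich_bind_le_of_coupling (c : Y → Y → ℝ≥0∞) {I : Type*} (ω : PMF I)
    (f g : I → PMF Y) :
    kantorovich c (ω.bind f) (ω.bind g) ≤ ∑' i, ω i * kantorovich c (f i) (g i) := by
  refine ENNReal.le_of_forall_pos_le_add fun ε hε _ => ?_
  choose η hη hle using fun i => exists_matching_le_add c (f i) (g i)
    (ENNReal.coe_ne_zero.2 hε.ne')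
  have hm : ω.bind η ∈ Matchings (ω.bind f) (ω.bind g) := by
    constructor
    · rw [PMF.map_bind]; exact congrArg _ (funext fun i => (hη i).1)
    · rw [PMF.map_bind]; exact congrArg _ (funext fun i => (hη i).2)
  refine (kantorovich_le_of_matching c hm).trans ?_
  rw [tsum_mul_bind (fun z : Y × Y => c z.1 z.2)]
  refine (ENNReal.tsum_le_tsum fun i => mul_le_mul_right (hle i) _).trans_eq ?_
  simp only [mul_add, ENNReal.tsum_add, ENNReal.tsum_mul_right, ω.tsum_coe, one_mul]

/-- Both mixtures are rewritten as mixtures over `ω`, whose marginals are `π` and `π'`. -/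
theorem kantorovich_bind_le (c : Y → Y → ℝ≥0∞) {π π' : PMF X} {ω : PMF (X × X)}
    (hω : ω ∈ Matchings π π') (f g : X → PMF Y) :
    kantorovich c (π.bind f) (π'.bind g) ≤
      ∑' x : X × X, ω x * kantorovich c (f x.1) (g x.2) := by
  have := kantorovich_bind_le_of_coupling c ω (fun x => f x.1) fun x => g x.2
  rwa [← hω.1, ← hω.2, PMF.bind_map, PMF.bind_map]

theorem kantorovich_pure_le (d : X → X → ℝ≥0∞) (x y : X) :
    kantorovich d (PMF.pure x) (PMF.pure y) ≤ d x y := by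
  have hm : PMF.pure (x, y) ∈ Matchings (PMF.pure x) (PMF.pure y) := by
    constructor <;> simp [PMF.pure_map]
  refine (kantorovich_le_of_matching d hm).trans_eq ?_
  rw [tsum_eq_single (x, y) fun z hz => by simp [hz]]
  simp

theorem kantorovich_self {d : X → X → ℝ≥0∞} (h : ∀ x, d x x = 0) (π : PMF X) :
    kantorovich d π π = 0 := by
  have hm : π.map (fun x => (x, x)) ∈ Matchings π π := by
    constructor <;> exact (PMF.map_comp _ _ _).trans π.map_id
  refine le_antisymm ((kantorovich_le_of_matching d hm).trans_eq ?_) zero_le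
  rw [tsum_mul_map (fun z : X × X => d z.1 z.2)]
  simp [h]

/-- Where `π₂` vanishes, so does the whole fibre of `ω`; the convention for `0⁻¹` in the gluing is
therefore harmless. -/
theorem mul_inv_mul_of_matching_left {π₁ π₂ : PMF X} {ω : PMF (X × X)} (h : ω ∈ Matchings π₁ π₂)
    (x y : X) : ω (x, y) * ((π₂ y)⁻¹ * π₂ y) = ω (x, y) := by
  by_cases hy : π₂ y = 0
  · have : ω (x, y) = 0 :=
      ENNReal.tsum_eq_zero.1 ((tsum_prod_snd_eq_of_matching h y).trans hy) x
    simp [this]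
  · rw [ENNReal.inv_mul_cancel hy (π₂.apply_ne_top y), mul_one]

theorem mul_inv_mul_of_matching_right {π₂ π₃ : PMF X} {ω : PMF (X × X)}
    (h : ω ∈ Matchings π₂ π₃) (y z : X) : π₂ y * (π₂ y)⁻¹ * ω (y, z) = ω (y, z) := by
  by_cases hy : π₂ y = 0
  · have : ω (y, z) = 0 :=
      ENNReal.tsum_eq_zero.1 ((tsum_prod_fst_eq_of_matching h y).trans hy) z
    simp [this]
  · rw [ENNReal.mul_inv_cancel hy (π₂.apply_ne_top y), one_mul]

/-- Two matchings sharing the marginal `π₂` are glued so that the outer points are conditionally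
independent given the middle one. -/
theorem kantorovich_triangle {d : X → X → ℝ≥0∞} (h : ∀ x y z, d x z ≤ d x y + d y z)
    (π₁ π₂ π₃ : PMF X) :
    kantorovich d π₁ π₃ ≤ kantorovich d π₁ π₂ + kantorovich d π₂ π₃ := by
  simp only [kantorovich, ENNReal.add_iInf, ENNReal.iInf_add]
  refine le_iInf₂ fun ω' hω' => le_iInf₂ fun ω hω => ?_
  -- the gluing of `ω` and `ω'` along `π₂`
  let G : X → X → X → ℝ≥0∞ := fun x y z => ω (x, y) * (π₂ y)⁻¹ * ω' (y, z)
  have hGz : ∀ x y, ∑' z, G x y z = ω (x, y) := fun x y => by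
    simp only [G, ENNReal.tsum_mul_left, tsum_prod_fst_eq_of_matching hω', mul_assoc,
      mul_inv_mul_of_matching_left hω]
  have hGx : ∀ y z, ∑' x, G x y z = ω' (y, z) := fun y z => by
    simp only [G, ENNReal.tsum_mul_right, tsum_prod_snd_eq_of_matching hω,
      mul_inv_mul_of_matching_right hω']
  have h₁ : ∀ x, ∑' z, ∑' y, G x y z = π₁ x := fun x => by
    rw [ENNReal.tsum_comm]
    simp only [hGz, tsum_prod_fst_eq_of_matching hω]
  have h₃ : ∀ z, ∑' x, ∑' y, G x y z = π₃ z := fun z => by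
    rw [ENNReal.tsum_comm]
    simp only [hGx, tsum_prod_snd_eq_of_matching hω']
  have hsum : ∑' p : X × X, ∑' y, G p.1 y p.2 = 1 := by
    rw [ENNReal.tsum_prod']
    simp only [h₁, π₁.tsum_coe]
  let η : PMF (X × X) := ⟨fun p => ∑' y, G p.1 y p.2, hsum ▸ ENNReal.summable.hasSum⟩
  have hη : η ∈ Matchings π₁ π₃ := mem_matchings_of_tsum h₁ h₃
  refine (iInf₂_le η hη).trans ?_
  calc ∑' p : X × X, d p.1 p.2 * ∑' y, G p.1 y p.2
      = ∑' x, ∑' z, ∑' y, d x z * G x y z := by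
        rw [ENNReal.tsum_prod']
        simp only [ENNReal.tsum_mul_left]
    _ ≤ ∑' x, ∑' z, ∑' y, (d x y * G x y z + d y z * G x y z) := by
        gcongr with x z y
        rw [← add_mul]
        gcongr
        exact h x y z
    _ = (∑' x, ∑' y, ∑' z, d x y * G x y z) + ∑' y, ∑' z, ∑' x, d y z * G x y z := by
        simp only [ENNReal.tsum_add]
        congr 1
        · exact tsum_congr fun x => ENNReal.tsum_comm
        · rw [ENNReal.tsum_comm, ENNReal.tsum_comm (f := fun y z => ∑' x, d y z * G x y z)]
          exact tsum_congr fun z => ENNReal.tsum_comm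
    _ = (∑' p : X × X, d p.1 p.2 * ω p) + ∑' p : X × X, d p.1 p.2 * ω' p := by
        simp only [ENNReal.tsum_prod' (α := X) (β := X), ENNReal.tsum_mul_left, hGz, hGx]

/-- The cost is additive over coordinates, so a matching of the heads can be combined with
near-optimal matchings of the tails. -/
theorem kantorovich_prodPMF_le (d : X → X → ℝ≥0∞) {n : ℕ} (π π' : Fin n → PMF X) :
    kantorovich (fun x y : Fin n → X => ∑ i, d (x i) (y i)) (prodPMF π) (prodPMF π') ≤
      ∑ i, kantorovich d (π i) (π' i) := by
  induction n with
  | zero => exact (kantorovich_pure_le _ _ _).trans (by simp)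
  | succ n ih =>
    rw [Fin.sum_univ_succ, prodPMF, prodPMF]
    -- Only the head term is unfolded: its infimum provides the matching `ω`, while the tail stays a
    -- lifting for the induction hypothesis.
    conv_rhs => enter [1]; rw [kantorovich]
    simp only [ENNReal.iInf_add]
    refine le_iInf₂ fun ω hω => (kantorovich_bind_le _ hω _ _).trans ?_
    have key : ∀ x : X × X,
        kantorovich (fun x y : Fin (n + 1) → X => ∑ i, d (x i) (y i))
          ((prodPMF fun i => π i.succ).map fun xs => Fin.cons x.1 xs)
          ((prodPMF fun i => π' i.succ).map fun xs => Fin.cons x.2 xs) ≤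
        d x.1 x.2 + ∑ i : Fin n, kantorovich d (π i.succ) (π' i.succ) := by
      intro x
      refine (kantorovich_map_le _ _ _ _ _).trans ?_
      simp only [Fin.sum_univ_succ, Fin.cons_zero, Fin.cons_succ]
      exact (kantorovich_const_add_le _ _ _ _).trans (add_le_add_right (ih _ _) _)
    refine (ENNReal.tsum_le_tsum fun x => mul_le_mul_right (key x) _).trans_eq ?_
    simp only [mul_add, ENNReal.tsum_add, ENNReal.tsum_mul_right, ω.tsum_coe, one_mul]
    simp only [mul_comm]

end Kantorovich

/-! ### Existence of the bisimilarity metric -/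

/-- The triangle inequality survives suprema but not infima in general, which is why the metrics are
approached from below. -/
theorem isPseudometric_sSup {X : Type u} {S : Set (X → X → ℝ≥0∞)}
    (hS : ∀ d ∈ S, IsPseudometric d) : IsPseudometric (sSup S) where
  le_one x y := by
    simp only [sSup_apply, iSup_apply]
    exact iSup_le fun d => (hS d d.2).le_one x y
  refl x := by
    simp only [sSup_apply, iSup_apply]
    exact le_antisymm (iSup_le fun d => ((hS d d.2).refl x).le) zero_le
  symm x y := by
    simp only [sSup_apply, iSup_apply]
    exact iSup_congr fun d => (hS d d.2).symm x y
  triangle x y z := by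
    simp only [sSup_apply, iSup_apply]
    refine iSup_le fun d => ((hS d d.2).triangle x y z).trans (add_le_add ?_ ?_)
    · exact le_iSup (fun e : S => (e : X → X → ℝ≥0∞) x y) d
    · exact le_iSup (fun e : S => (e : X → X → ℝ≥0∞) y z) d

/-! ### The bisimulation functional and its prefixed points. -/

section Step

variable {L : Signature.{u}} {A : Type v} (M : PTS L A) (lam : ℝ≥0∞)

/-- The cost of simulating the transitions of `t` by `t'`. -/
noncomputable def simCost (d : Proc L → Proc L → ℝ≥0∞) (t t' : Proc L) : ℝ≥0∞ :=
  ⨆ (a) (π) (_ : M t a π), ⨅ (π') (_ : M t' a π'), lam * kantorovich d π π'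

/-- The functional whose prefixed points are the bisimulation metrics. -/
noncomputable def bisimStep (d : Proc L → Proc L → ℝ≥0∞) (t t' : Proc L) : ℝ≥0∞ :=
  min 1 (max (simCost M lam d t t') (simCost M lam d t' t))

variable {M lam}

theorem simCost_mono {c d : Proc L → Proc L → ℝ≥0∞} (h : c ≤ d) (t t' : Proc L) :
    simCost M lam c t t' ≤ simCost M lam d t t' :=
  iSup_mono fun _ => iSup₂_mono fun _ _ => iInf₂_mono fun _ _ =>
    mul_le_mul_right (kantorovich_mono h _ _) _

theorem bisimStep_mono {c d : Proc L → Proc L → ℝ≥0∞} (h : c ≤ d) :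
    bisimStep M lam c ≤ bisimStep M lam d := fun _ _ =>
  min_le_min le_rfl (max_le_max (simCost_mono h _ _) (simCost_mono h _ _))

theorem simCost_le_iff_forall {d : Proc L → Proc L → ℝ≥0∞} {t t' : Proc L} {c : ℝ≥0∞} :
    simCost M lam d t t' ≤ c ↔
      ∀ a π, M t a π → ⨅ (π') (_ : M t' a π'), lam * kantorovich d π π' ≤ c := by
  simp only [simCost, iSup_le_iff]

theorem simCost_le {d : Proc L → Proc L → ℝ≥0∞} {t t' : Proc L} {c : ℝ≥0∞}
    (h : ∀ a π, M t a π → ∃ π', M t' a π' ∧ lam * kantorovich d π π' ≤ c) :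
    simCost M lam d t t' ≤ c := by
  rw [simCost_le_iff_forall]
  intro a π hπ
  obtain ⟨π', hπ', hle⟩ := h a π hπ
  exact (iInf₂_le π' hπ').trans hle

theorem simCost_self {d : Proc L → Proc L → ℝ≥0∞} (hd : ∀ t, d t t = 0) (t : Proc L) :
    simCost M lam d t t = 0 :=
  le_antisymm (simCost_le fun _ π hπ => ⟨π, hπ, by simp [kantorovich_self hd]⟩) zero_le

/-- Answers are composed through the middle process; a missing answer makes an infimum `⊤`, and the
bound is trivial. -/
theorem simCost_triangle {d : Proc L → Proc L → ℝ≥0∞} (hd : ∀ x y z, d x z ≤ d x y + d y z)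
    (t₁ t₂ t₃ : Proc L) :
    simCost M lam d t₁ t₃ ≤ simCost M lam d t₁ t₂ + simCost M lam d t₂ t₃ := by
  rw [simCost_le_iff_forall]
  intro a π₁ h₁
  refine le_trans ?_ (add_le_add_left (simCost_le_iff_forall.1 le_rfl a π₁ h₁) _)
  simp only [ENNReal.iInf_add]
  refine le_iInf₂ fun π₂ h₂ => ?_
  refine le_trans ?_ (add_le_add_right (simCost_le_iff_forall.1 le_rfl a π₂ h₂) _)
  simp only [ENNReal.add_iInf]
  refine le_iInf₂ fun π₃ h₃ => (iInf₂_le π₃ h₃).trans ?_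
  rw [← mul_add]
  exact mul_le_mul_right (kantorovich_triangle hd _ _ _) _

theorem isPseudometric_bisimStep {d : Proc L → Proc L → ℝ≥0∞} (hd : IsPseudometric d) :
    IsPseudometric (bisimStep M lam d) where
  le_one _ _ := min_le_left _ _
  refl t := by simp [bisimStep, simCost_self hd.refl]
  symm t t' := by rw [bisimStep, bisimStep, max_comm]
  triangle t₁ t₂ t₃ := by
    simp only [bisimStep]
    have h₁ := simCost_triangle (M := M) (lam := lam) hd.triangle t₁ t₂ t₃
    have h₂ := simCost_triangle (M := M) (lam := lam) hd.triangle t₃ t₂ t₁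
    have h₃ : max (simCost M lam d t₁ t₃) (simCost M lam d t₃ t₁) ≤
        max (simCost M lam d t₁ t₂) (simCost M lam d t₂ t₁) +
          max (simCost M lam d t₂ t₃) (simCost M lam d t₃ t₂) := by
      refine max_le (h₁.trans ?_) (h₂.trans ?_)
      · exact add_le_add (le_max_left _ _) (le_max_left _ _)
      · rw [add_comm]
        exact add_le_add (le_max_right _ _) (le_max_right _ _)
    -- If a summand on the right is truncated to `1`, the bound on the left suffices.
    rcases le_total 1 (max (simCost M lam d t₁ t₂) (simCost M lam d t₂ t₁)) with h | h
    · rw [min_eq_left h]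
      exact (min_le_left _ _).trans le_self_add
    rcases le_total 1 (max (simCost M lam d t₂ t₃) (simCost M lam d t₃ t₂)) with h' | h'
    · rw [min_eq_left h']
      exact (min_le_left _ _).trans le_add_self
    rw [min_eq_right h, min_eq_right h']
    exact (min_le_right _ _).trans h₃

theorem IsBisimMetric.bisimStep_le {d : Proc L → Proc L → ℝ≥0∞} (hd : IsBisimMetric M lam d) :
    bisimStep M lam d ≤ d := by
  intro t t'
  rcases (hd.pseudometric.le_one t t').lt_or_eq with h | h
  · refine (min_le_right _ _).trans (max_le (simCost_le (hd.transfer t t' h)) ?_)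
    rw [hd.pseudometric.symm] at h ⊢
    exact simCost_le (hd.transfer t' t h)
  · rw [h]
    exact min_le_left _ _

/-- The functional only bounds an infimum over answers, whereas transfer demands an actual answer;
finiteness makes the infimum a minimum. -/
theorem isBisimMetric_of_bisimStep_le (hM : ∀ t a, {π | M t a π}.Finite)
    {d : Proc L → Proc L → ℝ≥0∞} (hd : IsPseudometric d) (h : bisimStep M lam d ≤ d) :
    IsBisimMetric M lam d where
  pseudometric := hd
  transfer t t' hlt a π hπ := by
    have h₁ : simCost M lam d t t' ≤ d t t' := by
      rcases min_le_iff.1 (h t t') with h' | h'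
      · exact absurd h' hlt.not_ge
      · exact (le_max_left _ _).trans h'
    have h₂ := simCost_le_iff_forall.1 h₁ a π hπ
    -- Without an answer the infimum is `⊤`, contradicting a distance below `1`.
    rcases Set.eq_empty_or_nonempty {π' | M t' a π'} with he | hne
    · have : ⨅ (π') (_ : M t' a π'), lam * kantorovich d π π' = ⊤ :=
        iInf₂_eq_top.2 fun π' hπ' => (Set.eq_empty_iff_forall_notMem.1 he π' hπ').elim
      rw [this, top_le_iff] at h₂
      exact absurd hlt (by simp [h₂])
    · obtain ⟨π', hπ', hmin⟩ :=
        Set.exists_min_image _ (fun π' => lam * kantorovich d π π') (hM t' a) hne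
      exact ⟨π', hπ', (le_iInf₂ hmin).trans h₂⟩

/-- On an image-finite PTS the bisimilarity metric exists. -/
theorem exists_isBisimilarityMetric (hM : ∀ t a, {π | M t a π}.Finite) :
    ∃ d, IsBisimilarityMetric M lam d := by
  let S : Set (Proc L → Proc L → ℝ≥0∞) :=
    {c | IsPseudometric c ∧ ∀ e, IsBisimMetric M lam e → c ≤ e}
  have hS : IsPseudometric (sSup S) := isPseudometric_sSup fun c hc => hc.1
  have hle : ∀ e, IsBisimMetric M lam e → sSup S ≤ e := fun e he => sSup_le fun c hc => hc.2 e he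
  -- The step of `sSup S` again lies in `S`, hence below `sSup S`.
  exact ⟨sSup S, isBisimMetric_of_bisimStep_le hM hS (le_sSup ⟨isPseudometric_bisimStep hS,
    fun e he => (bisimStep_mono (hle e he)).trans he.bisimStep_le⟩), fun e he => hle e he⟩

end Step

/-! ### Image finiteness of the induced model. -/

section ImageFinite

variable {L : Signature.{u}} {A : Type v}

/-- A transition is determined by one of finitely many rules with its label and by the distributions
in its finitely many positive premises, which range over finite sets by induction. -/
theorem PTSS.finite_inducedModel (P : PTSS L A) (t : Proc L) :
    ∀ a, {π | P.inducedModel t a π}.Finite := by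
  induction t with
  | var x => exact x.elim
  | func f ts ih =>
    intro a
    refine ((P.finite_rules f a).biUnion fun r _ =>
      (Set.Finite.pi' fun k => ih (r.pos k).1 (r.pos k).2).image
        fun ρ => r.target.eval ts ρ).subset ?_
    intro π hπ
    simp only [Set.mem_ofPred_eq] at hπ
    rw [PTSS.inducedModel] at hπ
    obtain ⟨r, hr, ρ, hp, ha, rfl⟩ := hπ
    exact Set.mem_biUnion (x := r) ⟨hr, ha.symm⟩ ⟨ρ, hp.1, rfl⟩

end ImageFinite

/-! ### Non-expansiveness -/

section NonExpansive

variable {L : Signature.{u}} {A : Type v}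

/-- If the distances of the arguments are below `1`, then each instance of a rule for the first
tuple of arguments is matched by an instance of the same rule for the second. -/
theorem IsBisimMetric.exists_premises {M : PTS L A} {lam : ℝ≥0∞}
    {d : Proc L → Proc L → ℝ≥0∞} (hd : IsBisimMetric M lam d) {n : ℕ} (r : PGSOSRule L A n)
    {s t : Fin n → Proc L} (hst : ∀ i, d (s i) (t i) < 1) {ρ : Fin r.numPos → PMF (Proc L)}
    (h : r.Premises M s ρ) :
    ∃ ρ', r.Premises M t ρ' ∧
      ∀ k, lam * kantorovich d (ρ k) (ρ' k) ≤ d (s (r.pos k).1) (t (r.pos k).1) := by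
  choose ρ' hρ' hle using fun k => hd.transfer _ _ (hst (r.pos k).1) _ _ (h.1 k)
  refine ⟨ρ', ⟨hρ', fun q hq π hπ => ?_⟩, hle⟩
  -- Negative premises use transfer backwards: a forbidden transition of `t` would be answered by
  -- one of `s`.
  obtain ⟨π', hπ', -⟩ := hd.transfer _ _ (hd.pseudometric.symm _ _ ▸ hst q.1) _ _ hπ
  exact h.2 q hq π' hπ'

variable {lam : ℝ≥0∞} {d e : Proc L → Proc L → ℝ≥0∞}

theorem kantorovich_eval_app_le {Vs Vd : Type} {n : ℕ} {f : L.Functions n}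
    (he : ∀ s t : Fin n → Proc L, e (.func f s) (.func f t) ≤ ∑ i, d (s i) (t i))
    (θ : Fin n → DTerm L Vs Vd) (s t : Vs → Proc L) (ρ ρ' : Vd → PMF (Proc L)) :
    kantorovich e ((DTerm.app f θ).eval s ρ) ((DTerm.app f θ).eval t ρ') ≤
      ∑ i, kantorovich d ((θ i).eval s ρ) ((θ i).eval t ρ') := by
  rw [DTerm.eval, DTerm.eval]
  exact (kantorovich_map_le _ _ _ _ _).trans
    ((kantorovich_mono (fun x y => he x y) _ _).trans (kantorovich_prodPMF_le _ _ _))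

/-- Both sides have the same weights, so each index is coupled with itself and the bounds are
averaged, not added. -/
theorem mul_kantorovich_eval_sum_le {Vs Vd I : Type} (p : PMF I)
    (θ : I → DTerm L Vs Vd) (s t : Vs → Proc L) (ρ ρ' : Vd → PMF (Proc L)) {c : ℝ≥0∞}
    (h : ∀ i, lam * kantorovich e ((θ i).eval s ρ) ((θ i).eval t ρ') ≤ c) :
    lam * kantorovich e ((DTerm.sum p θ).eval s ρ) ((DTerm.sum p θ).eval t ρ') ≤ c := by
  rw [DTerm.eval, DTerm.eval]
  refine (mul_le_mul_right (kantorovich_bind_le_of_coupling _ _ _ _) _).trans ?_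
  rw [← ENNReal.tsum_mul_left]
  calc ∑' i, lam * (p i * kantorovich e ((θ i).eval s ρ) ((θ i).eval t ρ'))
      ≤ ∑' i, p i * c := by
        refine ENNReal.tsum_le_tsum fun i => ?_
        rw [mul_left_comm]
        exact mul_le_mul_right (h i) _
    _ = c := by rw [ENNReal.tsum_mul_right, p.tsum_coe, one_mul]

/-- This is where `lam ≤ 1` enters: an argument that does not move has its distance carried into the
target without any premise to absorb the discount. -/
theorem mul_kantorovich_dirac_le (hlam : lam ≤ 1) (x y : Proc L) :
    lam * kantorovich d (PMF.pure x) (PMF.pure y) ≤ d x y :=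
  (mul_le_mul' hlam (kantorovich_pure_le d x y)).trans_eq (one_mul _)

end NonExpansive

/-! ### The rules of `PA` in a disjoint extension. -/

section PA

variable {L : Signature.{u}} {A : Type v} {tick : A} {P : PTSS L A} {ι : (paSig A).LHom L}

theorem PTSS.IsDisjointExtension.inducedModel_func_iff
    (hP : PTSS.IsDisjointExtension ι (paPTSS tick) P) {n : ℕ} (f : PAOp A n)
    (s : Fin n → Proc L) (a : A) (π : PMF (Proc L)) :
    P.inducedModel (.func (ι.onFunction f) s) a π ↔
      ∃ r ∈ paRules tick f, ∃ ρ, (PGSOSRule.onLHom ι r).Premises P.inducedModel s ρ ∧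
        a = r.act ∧ π = (r.target.onLHom ι).eval s ρ := by
  have hrules : P.rules (ι.onFunction f) = PGSOSRule.onLHom ι '' paRules tick f := hP.rules_eq f
  rw [PTSS.inducedModel, hrules]
  constructor
  · rintro ⟨_, ⟨r, hr, rfl⟩, ρ, hp, ha, hπ⟩
    exact ⟨r, hr, ρ, hp, ha, hπ⟩
  · rintro ⟨r, hr, ρ, hp, ha, hπ⟩
    exact ⟨_, ⟨r, hr, rfl⟩, ρ, hp, ha, hπ⟩

variable {lam : ℝ≥0∞} {d e : Proc L → Proc L → ℝ≥0∞}

/-- Two metrics are kept apart: `e` measures the composed processes, `d` their components. -/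
theorem mul_kantorovich_eval_bin_le {f : PAOp A 2}
    (he : ∀ s t : Fin 2 → Proc L,
      e (.func (ι.onFunction f) s) (.func (ι.onFunction f) t) ≤ ∑ i, d (s i) (t i))
    {k : ℕ} (θ₁ θ₂ : Tgt A k) (s t : Fin 2 → Proc L) (ρ ρ' : Fin k → PMF (Proc L))
    {c₁ c₂ : ℝ≥0∞}
    (h₁ : lam * kantorovich d ((θ₁.onLHom ι).eval s ρ) ((θ₁.onLHom ι).eval t ρ') ≤ c₁)
    (h₂ : lam * kantorovich d ((θ₂.onLHom ι).eval s ρ) ((θ₂.onLHom ι).eval t ρ') ≤ c₂) :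
    lam * kantorovich e (((bin f θ₁ θ₂).onLHom ι).eval s ρ)
      (((bin f θ₁ θ₂).onLHom ι).eval t ρ') ≤ c₁ + c₂ := by
  refine (mul_le_mul_right (kantorovich_eval_app_le he (fun i => (![θ₁, θ₂] i).onLHom ι) s t ρ ρ') _).trans ?_
  rw [Fin.sum_univ_two, mul_add]
  exact add_le_add h₁ h₂

theorem mul_kantorovich_eval_choice_le {p : ℝ≥0∞} {hp : p ≤ 1}
    {k : ℕ} (θ₁ θ₂ : Tgt A k) (s t : Fin 2 → Proc L) (ρ ρ' : Fin k → PMF (Proc L))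
    {c : ℝ≥0∞}
    (h₁ : lam * kantorovich e ((θ₁.onLHom ι).eval s ρ) ((θ₁.onLHom ι).eval t ρ') ≤ c)
    (h₂ : lam * kantorovich e ((θ₂.onLHom ι).eval s ρ) ((θ₂.onLHom ι).eval t ρ') ≤ c) :
    lam * kantorovich e (((DTerm.choice p hp θ₁ θ₂).onLHom ι).eval s ρ)
      (((DTerm.choice p hp θ₁ θ₂).onLHom ι).eval t ρ') ≤ c := by
  rw [DTerm.choice, DTerm.onLHom]
  exact mul_kantorovich_eval_sum_le _ _ _ _ _ _ (Fin.forall_fin_two.2 ⟨h₁, h₂⟩)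

theorem mul_kantorovich_eval_dirac_var_le (hlam : lam ≤ 1) {n k : ℕ} (i : Fin n)
    (s t : Fin n → Proc L) (ρ ρ' : Fin k → PMF (Proc L)) :
    lam * kantorovich d
      (((DTerm.dirac (.var i) : DTerm (paSig A) (Fin n) (Fin k)).onLHom ι).eval s ρ)
      (((DTerm.dirac (.var i) : DTerm (paSig A) (Fin n) (Fin k)).onLHom ι).eval t ρ') ≤
        d (s i) (t i) :=
  mul_kantorovich_dirac_le hlam _ _

theorem kantorovich_eval_dnil (he : ∀ x, e x x = 0) {n k : ℕ}
    (s t : Fin n → Proc L) (ρ ρ' : Fin k → PMF (Proc L)) :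
    kantorovich e (((dnil : DTerm (paSig A) (Fin n) (Fin k)).onLHom ι).eval s ρ)
      (((dnil : DTerm (paSig A) (Fin n) (Fin k)).onLHom ι).eval t ρ') = 0 := by
  have : ((dnil : DTerm (paSig A) (Fin n) (Fin k)).onLHom ι).eval s ρ =
      ((dnil : DTerm (paSig A) (Fin n) (Fin k)).onLHom ι).eval t ρ' := by
    simp only [dnil, DTerm.onLHom, DTerm.eval, FirstOrder.Language.LHom.onTerm,
      FirstOrder.Language.Term.subst]
    congr 2
    exact Subsingleton.elim _ _
  rw [this, kantorovich_self he]

/-- The targets of the rules of `PA` do not expand distances. -/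
theorem mul_kantorovich_target_le (hlam : lam ≤ 1) (he : ∀ x, e x x = 0) (hed : e ≤ d)
    (hne : ∀ {n : ℕ} (f : PAOp A n) (s t : Fin n → Proc L),
      e (.func (ι.onFunction f) s) (.func (ι.onFunction f) t) ≤ ∑ i, d (s i) (t i))
    {n : ℕ} (f : PAOp A n) {r : PGSOSRule (paSig A) A n} (hr : r ∈ paRules tick f)
    (s t : Fin n → Proc L) (ρ ρ' : Fin r.numPos → PMF (Proc L))
    (hρ : ∀ k, lam * kantorovich d (ρ k) (ρ' k) ≤ d (s (r.pos k).1) (t (r.pos k).1)) :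
    lam * kantorovich e ((r.target.onLHom ι).eval s ρ) ((r.target.onLHom ι).eval t ρ') ≤
      ∑ i, d (s i) (t i) := by
  -- This settles targets that are a single derivative, which cost only one summand.
  have hρe : ∀ k, lam * kantorovich e (ρ k) (ρ' k) ≤ ∑ i, d (s i) (t i) := fun k =>
    (mul_le_mul_right (kantorovich_mono hed _ _) _).trans ((hρ k).trans
      (Finset.single_le_sum (f := fun i => d (s i) (t i)) (fun _ _ => zero_le)
        (Finset.mem_univ _)))
  have hnil : ∀ {m k : ℕ} (s t : Fin m → Proc L) (ρ ρ' : Fin k → PMF (Proc L)) (c : ℝ≥0∞),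
      lam * kantorovich e (((dnil : DTerm (paSig A) (Fin m) (Fin k)).onLHom ι).eval s ρ)
        (((dnil : DTerm (paSig A) (Fin m) (Fin k)).onLHom ι).eval t ρ') ≤ c := fun s t ρ ρ' c => by
    rw [kantorovich_eval_dnil he, mul_zero]
    exact zero_le
  have hbin := fun {k : ℕ} (g : PAOp A 2) (θ₁ θ₂ : Tgt A k) =>
    mul_kantorovich_eval_bin_le (lam := lam) (hne g) θ₁ θ₂
  have hvar := fun {n k : ℕ} => mul_kantorovich_eval_dirac_var_le (d := d) (ι := ι) hlam
    (n := n) (k := k)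
  cases f with
  | nil => exact hr.elim
  | skip =>
    obtain rfl := hr
    exact hnil _ _ _ _ _
  | pre a p hp =>
    obtain rfl := hr
    refine mul_kantorovich_eval_sum_le _ _ _ _ _ _ fun i => ?_
    refine (mul_le_mul_right (kantorovich_mono hed _ _) _).trans ((hvar i _ _ _ _).trans ?_)
    exact Finset.single_le_sum (f := fun i => d (s i) (t i)) (fun _ _ => zero_le)
      (Finset.mem_univ i)
  | seq =>
    obtain ⟨a, -, rfl⟩ | ⟨a, rfl⟩ := hr
    · rw [Fin.sum_univ_two]
      exact hbin _ _ _ _ _ _ _ (hρ (0 : Fin 1)) (hvar 1 _ _ _ _)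
    · exact hρe (1 : Fin 2)
  | alt => obtain ⟨a, rfl⟩ | ⟨a, rfl⟩ := hr <;> exact hρe (0 : Fin 1)
  | palt p h₀ h =>
    obtain (⟨a, rfl⟩ | ⟨a, rfl⟩) | ⟨a, rfl⟩ := hr
    · exact hρe (0 : Fin 1)
    · exact hρe (0 : Fin 1)
    · exact mul_kantorovich_eval_choice_le _ _ _ _ _ _ (hρe (0 : Fin 2)) (hρe (1 : Fin 2))
  | sync =>
    obtain ⟨a, -, rfl⟩ | rfl := hr
    · rw [Fin.sum_univ_two]
      exact hbin _ _ _ _ _ _ _ (hρ (0 : Fin 2)) (hρ (1 : Fin 2))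
    · exact hnil _ _ _ _ _
  | async =>
    obtain (⟨a, -, rfl⟩ | ⟨a, -, rfl⟩) | rfl := hr
    · rw [Fin.sum_univ_two]
      exact hbin _ _ _ _ _ _ _ (hρ (0 : Fin 1)) (hvar 1 _ _ _ _)
    · rw [Fin.sum_univ_two]
      exact hbin _ _ _ _ _ _ _ (hvar 0 _ _ _ _) (hρ (0 : Fin 1))
    · exact hnil _ _ _ _ _
  | pasync p h₀ h =>
    obtain ((⟨a, -, rfl⟩ | ⟨a, -, rfl⟩) | ⟨a, -, rfl⟩) | rfl := hr
    · rw [Fin.sum_univ_two]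
      exact hbin _ _ _ _ _ _ _ (hρ (0 : Fin 1)) (hvar 1 _ _ _ _)
    · rw [Fin.sum_univ_two]
      exact hbin _ _ _ _ _ _ _ (hvar 0 _ _ _ _) (hρ (0 : Fin 1))
    · rw [Fin.sum_univ_two]
      -- Each branch moves one argument and keeps the other, so each costs at most the whole sum,
      -- and averaging does not exceed it.
      exact mul_kantorovich_eval_choice_le _ _ _ _ _ _
        (hbin _ _ _ _ _ _ _ (hρ (0 : Fin 2)) (hvar 1 _ _ _ _))
        (hbin _ _ _ _ _ _ _ (hvar 0 _ _ _ _) (hρ (1 : Fin 2)))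
    · exact hnil _ _ _ _ _
  | csp B =>
    obtain ((⟨a, -, rfl⟩ | rfl) | ⟨a, -, rfl⟩) | ⟨a, -, rfl⟩ := hr
    · rw [Fin.sum_univ_two]
      exact hbin _ _ _ _ _ _ _ (hρ (0 : Fin 2)) (hρ (1 : Fin 2))
    · exact hnil _ _ _ _ _
    · rw [Fin.sum_univ_two]
      exact hbin _ _ _ _ _ _ _ (hρ (0 : Fin 1)) (hvar 1 _ _ _ _)
    · rw [Fin.sum_univ_two]
      exact hbin _ _ _ _ _ _ _ (hvar 0 _ _ _ _) (hρ (0 : Fin 1))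

/-- Transfer for `d` supplies the matching rule instance; `e` only has to measure its target, so it
need not be a bisimulation metric itself. -/
theorem simCost_func_le (hP : PTSS.IsDisjointExtension ι (paPTSS tick) P) (hlam : lam ≤ 1)
    (hd : IsBisimMetric P.inducedModel lam d) (he : ∀ x, e x x = 0) (hed : e ≤ d)
    (hne : ∀ {n : ℕ} (f : PAOp A n) (s t : Fin n → Proc L),
      e (.func (ι.onFunction f) s) (.func (ι.onFunction f) t) ≤ ∑ i, d (s i) (t i))
    {n : ℕ} (f : PAOp A n) (s t : Fin n → Proc L) (hst : ∀ i, d (s i) (t i) < 1) :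
    simCost P.inducedModel lam e (.func (ι.onFunction f) s) (.func (ι.onFunction f) t) ≤
      ∑ i, d (s i) (t i) := by
  refine simCost_le fun a π hπ => ?_
  obtain ⟨r, hr, ρ, hp, rfl, rfl⟩ := (hP.inducedModel_func_iff f s a π).1 hπ
  obtain ⟨ρ', hp', hle⟩ := hd.exists_premises _ hst hp
  exact ⟨_, (hP.inducedModel_func_iff f t _ _).2 ⟨r, hr, ρ', hp', rfl, rfl⟩,
    mul_kantorovich_target_le hlam he hed hne f hr s t ρ ρ' hle⟩

/-- The operators of `PA` are non-expansive for the bisimilarity metric: the largest pseudometric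
below it for which they do not expand its distances is a bisimulation metric. -/
theorem IsBisimilarityMetric.nonExpansive (hP : PTSS.IsDisjointExtension ι (paPTSS tick) P)
    (hlam : lam ≤ 1) (hd : IsBisimilarityMetric P.inducedModel lam d) {n : ℕ} (f : PAOp A n) :
    NonExpansive d (ι.onFunction f) := by
  -- The right-hand side has the fixed `d`, not `c`, since transfer is known only for `d`.
  let S : Set (Proc L → Proc L → ℝ≥0∞) := {c | IsPseudometric c ∧ c ≤ d ∧
    ∀ {n : ℕ} (f : PAOp A n) (s t : Fin n → Proc L),
      c (.func (ι.onFunction f) s) (.func (ι.onFunction f) t) ≤ ∑ i, d (s i) (t i)}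
  have hS : IsPseudometric (sSup S) := isPseudometric_sSup fun c hc => hc.1
  have hle : sSup S ≤ d := sSup_le fun c hc => hc.2.1
  have hne : ∀ {n : ℕ} (f : PAOp A n) (s t : Fin n → Proc L),
      sSup S (.func (ι.onFunction f) s) (.func (ι.onFunction f) t) ≤ ∑ i, d (s i) (t i) := by
    intro n f s t
    simp only [sSup_apply, iSup_apply]
    exact iSup_le fun c => c.2.2.2 f s t
  have hstep : bisimStep P.inducedModel lam (sSup S) ∈ S := by
    refine ⟨isPseudometric_bisimStep hS, (bisimStep_mono hle).trans hd.1.bisimStep_le, ?_⟩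
    intro n f s t
    by_cases hst : ∀ i, d (s i) (t i) < 1
    · refine (min_le_right _ _).trans (max_le ?_ ?_)
      · exact simCost_func_le hP hlam hd.1 hS.refl hle hne f s t hst
      · simp only [hd.1.pseudometric.symm (s _)] at hst ⊢
        exact simCost_func_le hP hlam hd.1 hS.refl hle hne f t s hst
    -- An argument distance of at least `1` already pays for the truncated left side.
    · push Not at hst
      obtain ⟨i, hi⟩ := hst
      exact (min_le_left _ _).trans (hi.trans (Finset.single_le_sum
        (f := fun i => d (s i) (t i)) (fun _ _ => zero_le) (Finset.mem_univ i)))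
  have hbis : IsBisimMetric P.inducedModel lam (sSup S) :=
    isBisimMetric_of_bisimStep_le P.finite_inducedModel hS (le_sSup hstep)
  intro s t
  -- Leastness of `d` gives `d ≤ sSup S`.
  exact (hd.2 hbis _ _).trans (hne f s t)

end PA

end ProbPA

/-- In every disjoint extension `P` of the process algebra `P_PA` (along the inclusion `ι` of
signatures) the `lam`-bisimilarity metric exists, and every operator of `Σ_PA` is non-expansive
with respect to it. -/
theorem mainTheorem5 {A : Type v} (tick : A) {L : ProbPA.Signature.{u}} (P : ProbPA.PTSS L A)
    (ι : (ProbPA.paSig A).LHom L) (hP : ProbPA.PTSS.IsDisjointExtension ι (ProbPA.paPTSS tick) P)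
    (lam : ℝ≥0∞) (hlam₀ : 0 < lam) (hlam₁ : lam ≤ 1) :
    ∃ d : ProbPA.Proc L → ProbPA.Proc L → ℝ≥0∞, ProbPA.IsBisimilarityMetric P.inducedModel lam d ∧
      ∀ {n : ℕ} (f : ProbPA.PAOp A n), ProbPA.NonExpansive d (ι.onFunction f) := by
  obtain ⟨d, hd⟩ := ProbPA.exists_isBisimilarityMetric (lam := lam) P.finite_inducedModel
  exact ⟨d, hd, fun f => hd.nonExpansive hP hlam₁ f⟩
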